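/- Let $d\in\{2,3\}$ and let $\Omega\subset\mathbb R^d$ be a polyhedral domain, i.e. a nonempty connected open set that equals the interior of its closure and whose closure is a finite union of convex polytopes. Let $\mathfrak T$ be a quasi-uniform family of conforming triangulations (tetrahedralizations, if $d=3$) of $\Omega$: finite simplicial complexes that fill $\overline\Omega$, all of whose faces belong to $d$-simplices, such that for some $\gamma>0$ every element of every mesh $\mathcal T\in\mathfrak T$ contains a ball of radius $\gamma h$, where $h=h(\mathcal T)$ is the largest diameter of an element of $\mathcal T$. For $\mathcal T\in\mathfrak T$ let $V_h=\{v\in H^1_0(\Omega): v|_T\in P_1(T)\ \forall T\in\mathcal T\}$ (complex-valued functions), with nodal basis $\varphi_1,\dots,\varphi_n$ (one function for each mesh vertex lying in $\Omega$, $\varphi_i(p_j)=\delta_{ij}$). For $\kappa\in\mathbb R$ and a constant $\sigma>0$ put $$a(u,v)=(\nabla u,\nabla v)-\kappa^2(u,v)+\mathrm i\,\sigma(u,v),\qquad (u,v)=\int_\Omega u\,\overline v,$$ $A_{ji}=a(\varphi_i,\varphi_j)$, $K_{ji}=(\nabla\varphi_i,\nabla\varphi_j)$, $M_{ji}=(\varphi_i,\varphi_j)$.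 For $B\in\mathbb C^{n\times n}$ let $\mathcal F(B)=\{x^*Bx/x^*x : x\in\mathbb C^n,\ x\ne0\}$ be its field of values. (1) There are constants $c,C>0$, independent of $h$, $\sigma$ and $\kappa$ (depending only on $d$, $\Omega$ and the family of meshes), such that for all $\kappa\in\mathbb R$, all $\sigma>0$ and all meshes of the family, $K$ is invertible, $$\mathcal F(AK^{-1}M)\subset\Big\{z\in\mathbb C:\ ch^d-\frac{\kappa^2}{\sigma}\operatorname{Im}z\le\operatorname{Re}z\le Ch^d-\frac{\kappa^2}{\sigma}\operatorname{Im}z\Big\},$$ and $0\notin\mathcal F(AK^{-1}M)$. (2) Consequently the convergence rate of the right-preconditioned GMRES method does not depend on $h$: for all $\kappa\in\mathbb R$ and $\sigma>0$ there is $\rho\in[0,1)$, independent of $h$ (it may depend on $\kappa$, $\sigma$, $d$, $\Omega$ and the family), such that for every mesh of the family, every $b\in\mathbb C^n$ and every $m\ge0$, the $m$-th GMRES iterate $x_m$ for $AK^{-1}M\,x=b$ (a minimizer of the Euclidean norm $|AK^{-1}M\,x-b|$ over the span of $b,(AK^{-1}M)b,\dots,(AK^{-1}M)^{m-1}b$)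 satisfies $$|AK^{-1}M\,x_m-b|\le\rho^m|b|.$$ -/

import Mathlib

open MeasureTheory Filter Topology
open scoped ContDiff ComplexConjugate

noncomputable section

namespace HelmholtzFEM

/-- Euclidean space `ℝ^d`. -/
abbrev Pt (d : ℕ) : Type := EuclideanSpace ℝ (Fin d)

/-! ### Domains and triangulations -/

/-- A polyhedral domain: a nonempty connected open set which is the interior of its closure and
whose closure is a finite union of convex polytopes (so it is bounded). -/
structure IsPolyhedralDomain {d : ℕ} (Ω : Set (Pt d)) : Prop where
  isOpen : IsOpen Ω
  isConnected : IsConnected Ω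
  interior_closure : interior (closure Ω) = Ω
  exists_polytopes : ∃ P : Set (Finset (Pt d)), P.Finite ∧
    closure Ω = ⋃ s ∈ P, convexHull ℝ (s : Set (Pt d))

/-- The elements of a mesh: its `d`-dimensional simplices, each given by its `d + 1` vertices. -/
def cells {d : ℕ} (T : Geometry.SimplicialComplex ℝ (Pt d)) : Set (Finset (Pt d)) :=
  {s | s ∈ T.faces ∧ s.card = d + 1}

/-- `T` is a (conforming) triangulation or tetrahedralization of `Ω`: a finite simplicial complex,
all of whose faces belong to `d`-dimensional simplices, and which fills the closure of `Ω`. -/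
structure IsTriangulation {d : ℕ} (Ω : Set (Pt d)) (T : Geometry.SimplicialComplex ℝ (Pt d)) :
    Prop where
  finite : T.faces.Finite
  pure : ∀ s ∈ T.faces, ∃ t ∈ cells T, s ⊆ t
  space_eq : T.space = closure Ω

/-- The mesh size `h`: the largest diameter of an element. -/
def meshSize {d : ℕ} (T : Geometry.SimplicialComplex ℝ (Pt d)) : ℝ :=
  sSup ((fun s : Finset (Pt d) => Metric.diam (convexHull ℝ (s : Set (Pt d)))) '' cells T)

/-- A family of meshes is quasi-uniform: for one `γ > 0`, every element of every mesh of the family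
contains a ball of radius `γ h`, where `h` is the size of that mesh. -/
def IsQuasiUniform {d : ℕ} (F : Set (Geometry.SimplicialComplex ℝ (Pt d))) : Prop :=
  ∃ γ : ℝ, 0 < γ ∧ ∀ T ∈ F, ∀ s ∈ cells T,
    ∃ x : Pt d, Metric.closedBall x (γ * meshSize T) ⊆ convexHull ℝ (s : Set (Pt d))

/-! ### The Sobolev space `H¹₀(Ω)` -/

/-- Complex-valued smooth functions with compact support in `Ω`. -/
structure IsTestFunction {d : ℕ} (Ω : Set (Pt d)) (ψ : Pt d → ℂ) : Prop where
  contDiff : ContDiff ℝ ∞ ψ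
  hasCompactSupport : HasCompactSupport ψ
  tsupport_subset : tsupport ψ ⊆ Ω

/-- The classical partial derivative `∂ψ/∂xᵢ`. -/
def classicalPartial {d : ℕ} (i : Fin d) (ψ : Pt d → ℂ) (x : Pt d) : ℂ :=
  fderiv ℝ ψ x (EuclideanSpace.single i 1)

/-- `g` is a weak partial derivative `∂u/∂xᵢ` of `u` in `Ω` with `g ∈ L²(Ω)`. -/
def HasWeakPartial {d : ℕ} (Ω : Set (Pt d)) (i : Fin d) (u g : Pt d → ℂ) : Prop :=
  MemLp g 2 (volume.restrict Ω) ∧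
    ∀ ψ : Pt d → ℂ, IsTestFunction Ω ψ →
      ∫ x in Ω, u x * classicalPartial i ψ x = - ∫ x in Ω, g x * ψ x

open Classical in
/-- The weak partial derivative `∂u/∂xᵢ` in `L²(Ω)` (determined almost everywhere in an open `Ω`,
when it exists). -/
def weakPartial {d : ℕ} (Ω : Set (Pt d)) (i : Fin d) (u : Pt d → ℂ) : Pt d → ℂ :=
  if h : ∃ g, HasWeakPartial Ω i u g then Classical.choose h else 0

/-- `u ∈ H¹₀(Ω)`: `u` and its weak first derivatives are in `L²(Ω)`, and `u` is a limit of
test functions in the norm of `H¹(Ω)`. -/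
def MemH10 {d : ℕ} (Ω : Set (Pt d)) (u : Pt d → ℂ) : Prop :=
  MemLp u 2 (volume.restrict Ω) ∧
    ∃ g : Fin d → Pt d → ℂ, (∀ i, HasWeakPartial Ω i u (g i)) ∧
      ∃ ψ : ℕ → Pt d → ℂ, (∀ m, IsTestFunction Ω (ψ m)) ∧
        Tendsto (fun m => eLpNorm (u - ψ m) 2 (volume.restrict Ω)) atTop (𝓝 0) ∧
        ∀ i, Tendsto (fun m => eLpNorm (g i - classicalPartial i (ψ m)) 2 (volume.restrict Ω))
          atTop (𝓝 0)

theorem IsTestFunction.zero {d : ℕ} (Ω : Set (Pt d)) : IsTestFunction Ω (0 : Pt d → ℂ) where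
  contDiff := contDiff_const
  hasCompactSupport := HasCompactSupport.zero
  tsupport_subset := by simp [tsupport]

theorem IsTestFunction.add {d : ℕ} {Ω : Set (Pt d)} {ψ χ : Pt d → ℂ}
    (hψ : IsTestFunction Ω ψ) (hχ : IsTestFunction Ω χ) : IsTestFunction Ω (ψ + χ) where
  contDiff := hψ.contDiff.add hχ.contDiff
  hasCompactSupport := hψ.hasCompactSupport.add hχ.hasCompactSupport
  tsupport_subset :=
    (tsupport_add ψ χ).trans (Set.union_subset hψ.tsupport_subset hχ.tsupport_subset)

theorem IsTestFunction.smul {d : ℕ} {Ω : Set (Pt d)} {ψ : Pt d → ℂ} (c : ℂ)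
    (hψ : IsTestFunction Ω ψ) : IsTestFunction Ω (c • ψ) where
  contDiff := hψ.contDiff.const_smul c
  hasCompactSupport := hψ.hasCompactSupport.smul_left (f := fun _ => c)
  tsupport_subset :=
    (tsupport_smul_subset_right (fun _ => c) ψ).trans hψ.tsupport_subset

theorem IsTestFunction.differentiable {d : ℕ} {Ω : Set (Pt d)} {ψ : Pt d → ℂ}
    (hψ : IsTestFunction Ω ψ) : Differentiable ℝ ψ :=
  hψ.contDiff.differentiable (by simp)

theorem IsTestFunction.memLp {d : ℕ} {Ω : Set (Pt d)} {ψ : Pt d → ℂ}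
    (hψ : IsTestFunction Ω ψ) : MemLp ψ 2 (volume.restrict Ω) :=
  (hψ.contDiff.continuous.memLp_of_hasCompactSupport hψ.hasCompactSupport).restrict Ω

theorem IsTestFunction.memLp_partial {d : ℕ} {Ω : Set (Pt d)} {ψ : Pt d → ℂ}
    (hψ : IsTestFunction Ω ψ) (i : Fin d) :
    MemLp (classicalPartial i ψ) 2 (volume.restrict Ω) := by
  have hc : Continuous (classicalPartial i ψ) :=
    (hψ.contDiff.continuous_fderiv (by simp)).clm_apply continuous_const
  have hs : HasCompactSupport (classicalPartial i ψ) :=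
    hψ.hasCompactSupport.fderiv_apply ℝ (EuclideanSpace.single i 1)
  exact (hc.memLp_of_hasCompactSupport hs).restrict Ω

theorem classicalPartial_add {d : ℕ} {Ω : Set (Pt d)} {ψ χ : Pt d → ℂ}
    (hψ : IsTestFunction Ω ψ) (hχ : IsTestFunction Ω χ) (i : Fin d) :
    classicalPartial i (ψ + χ) = classicalPartial i ψ + classicalPartial i χ := by
  ext x
  simp [classicalPartial, fderiv_add (hψ.differentiable x) (hχ.differentiable x)]

theorem classicalPartial_smul {d : ℕ} {Ω : Set (Pt d)} {ψ : Pt d → ℂ}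
    (hψ : IsTestFunction Ω ψ) (c : ℂ) (i : Fin d) :
    classicalPartial i (c • ψ) = c • classicalPartial i ψ := by
  ext x
  simp [classicalPartial, fderiv_const_smul (hψ.differentiable x) c]

theorem HasWeakPartial.add {d : ℕ} {Ω : Set (Pt d)} {i : Fin d} {u v g k : Pt d → ℂ}
    (hu : MemLp u 2 (volume.restrict Ω)) (hv : MemLp v 2 (volume.restrict Ω))
    (hg : HasWeakPartial Ω i u g) (hk : HasWeakPartial Ω i v k) :
    HasWeakPartial Ω i (u + v) (g + k) := by
  refine ⟨hg.1.add hk.1, fun ψ hψ => ?_⟩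
  simp only [Pi.add_apply, add_mul]
  have h₁ : Integrable (fun x => u x * classicalPartial i ψ x) (volume.restrict Ω) :=
    hu.integrable_mul (hψ.memLp_partial i)
  have h₂ : Integrable (fun x => v x * classicalPartial i ψ x) (volume.restrict Ω) :=
    hv.integrable_mul (hψ.memLp_partial i)
  have h₃ : Integrable (fun x => g x * ψ x) (volume.restrict Ω) := hg.1.integrable_mul hψ.memLp
  have h₄ : Integrable (fun x => k x * ψ x) (volume.restrict Ω) := hk.1.integrable_mul hψ.memLp
  rw [integral_add h₁ h₂, integral_add h₃ h₄, hg.2 ψ hψ, hk.2 ψ hψ]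
  ring

theorem HasWeakPartial.smul {d : ℕ} {Ω : Set (Pt d)} {i : Fin d} {u g : Pt d → ℂ} (c : ℂ)
    (hg : HasWeakPartial Ω i u g) : HasWeakPartial Ω i (c • u) (c • g) := by
  refine ⟨hg.1.const_smul c, fun ψ hψ => ?_⟩
  simp only [Pi.smul_apply, smul_eq_mul, mul_assoc]
  rw [integral_const_mul, integral_const_mul, hg.2 ψ hψ]
  ring

theorem tendsto_eLpNorm_add {d : ℕ} {μ : Measure (Pt d)} {u v : Pt d → ℂ}
    {f k : ℕ → Pt d → ℂ} (hu : MemLp u 2 μ) (hv : MemLp v 2 μ)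
    (hf : ∀ m, MemLp (f m) 2 μ) (hk : ∀ m, MemLp (k m) 2 μ)
    (h₁ : Tendsto (fun m => eLpNorm (u - f m) 2 μ) atTop (𝓝 0))
    (h₂ : Tendsto (fun m => eLpNorm (v - k m) 2 μ) atTop (𝓝 0)) :
    Tendsto (fun m => eLpNorm (u + v - (f m + k m)) 2 μ) atTop (𝓝 0) := by
  have h := h₁.add h₂
  rw [add_zero] at h
  refine tendsto_of_tendsto_of_tendsto_of_le_of_le tendsto_const_nhds h (fun _ => bot_le)
    (fun m => ?_)
  have e : u + v - (f m + k m) = (u - f m) + (v - k m) := by abel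
  simp only [e]
  exact eLpNorm_add_le (hu.sub (hf m)).1 (hv.sub (hk m)).1 (by norm_num)

theorem tendsto_eLpNorm_smul {d : ℕ} {μ : Measure (Pt d)} {u : Pt d → ℂ}
    {f : ℕ → Pt d → ℂ} (c : ℂ)
    (h : Tendsto (fun m => eLpNorm (u - f m) 2 μ) atTop (𝓝 0)) :
    Tendsto (fun m => eLpNorm (c • u - c • f m) 2 μ) atTop (𝓝 0) := by
  simp only [← smul_sub, eLpNorm_const_smul]
  have h' := ENNReal.Tendsto.const_mul (a := ‖c‖ₑ) h (Or.inr (by simp))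
  simpa using h'

/-- The space `H¹₀(Ω)`, as a space of functions. -/
def H10 {d : ℕ} (Ω : Set (Pt d)) : Submodule ℂ (Pt d → ℂ) where
  carrier := {u | MemH10 Ω u}
  zero_mem' := by
    have h0 : ∀ i : Fin d, classicalPartial i (0 : Pt d → ℂ) = 0 := by
      intro i
      ext x
      simp [classicalPartial]
    refine ⟨MemLp.zero, fun _ => 0, fun i => ⟨MemLp.zero, fun ψ _ => by simp⟩, fun _ => 0,
      fun _ => IsTestFunction.zero Ω, by simp, fun i => by simp [h0]⟩
  add_mem' := by
    rintro u v ⟨hu, g, hg, ψ, hψ, hψ₀, hψ₁⟩ ⟨hv, k, hk, χ, hχ, hχ₀, hχ₁⟩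
    refine ⟨hu.add hv, fun i => g i + k i, fun i => (hg i).add hu hv (hk i),
      fun m => ψ m + χ m, fun m => (hψ m).add (hχ m),
      tendsto_eLpNorm_add hu hv (fun m => (hψ m).memLp) (fun m => (hχ m).memLp) hψ₀ hχ₀,
      fun i => ?_⟩
    simp only [classicalPartial_add (hψ _) (hχ _)]
    exact tendsto_eLpNorm_add (hg i).1 (hk i).1 (fun m => (hψ m).memLp_partial i)
      (fun m => (hχ m).memLp_partial i) (hψ₁ i) (hχ₁ i)
  smul_mem' := by
    rintro c u ⟨hu, g, hg, ψ, hψ, hψ₀, hψ₁⟩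
    refine ⟨hu.const_smul c, fun i => c • g i, fun i => (hg i).smul c,
      fun m => c • ψ m, fun m => (hψ m).smul c, tendsto_eLpNorm_smul c hψ₀, fun i => ?_⟩
    simp only [classicalPartial_smul (hψ _)]
    exact tendsto_eLpNorm_smul c (hψ₁ i)

/-! ### First order finite elements -/

/-- The finite element space `V_h`: functions in `H¹₀(Ω)` (extended by zero outside `Ω`) whose
restriction to every element is a polynomial of degree at most one. -/
def Vh {d : ℕ} (Ω : Set (Pt d)) (T : Geometry.SimplicialComplex ℝ (Pt d)) :
    Submodule ℂ (Pt d → ℂ) where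
  carrier := {u | u ∈ H10 Ω ∧ (∀ x, x ∉ Ω → u x = 0) ∧
    ∀ s ∈ cells T, ∃ p : Pt d →ᵃ[ℝ] ℂ, Set.EqOn u p (convexHull ℝ (s : Set (Pt d)))}
  zero_mem' := ⟨zero_mem _, fun _ _ => rfl, fun _ _ => ⟨0, fun _ _ => rfl⟩⟩
  add_mem' := by
    rintro u v ⟨hu, hu₀, hu₁⟩ ⟨hv, hv₀, hv₁⟩
    refine ⟨add_mem hu hv, fun x hx => by simp [hu₀ x hx, hv₀ x hx], fun s hs => ?_⟩
    obtain ⟨p, hp⟩ := hu₁ s hs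
    obtain ⟨q, hq⟩ := hv₁ s hs
    exact ⟨p + q, fun x hx => by simp [hp hx, hq hx]⟩
  smul_mem' := by
    rintro c u ⟨hu, hu₀, hu₁⟩
    refine ⟨Submodule.smul_mem _ c hu, fun x hx => by simp [hu₀ x hx], fun s hs => ?_⟩
    obtain ⟨p, hp⟩ := hu₁ s hs
    exact ⟨c • p, fun x hx => by simp [hp hx]⟩

/-- `φ` is the usual finite element basis of `V_h`: for some enumeration `p` of the mesh vertices
lying in `Ω`, it is the basis with `φᵢ(pⱼ) = δᵢⱼ`. -/
def IsNodalBasis {d n : ℕ} {Ω : Set (Pt d)} {T : Geometry.SimplicialComplex ℝ (Pt d)}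
    (φ : Module.Basis (Fin n) ℂ (Vh Ω T)) : Prop :=
  ∃ p : Fin n → Pt d, Function.Injective p ∧ Set.range p = T.vertices ∩ Ω ∧
    ∀ i j, (φ i : Pt d → ℂ) (p j) = if i = j then 1 else 0

/-! ### Forms and matrices -/

/-- The `L²(Ω)` inner product `(u, v)`, linear in `u` and antilinear in `v`. -/
def l2Inner {d : ℕ} (Ω : Set (Pt d)) (u v : Pt d → ℂ) : ℂ :=
  ∫ x in Ω, u x * conj (v x)

/-- `(∇u, ∇v)`. -/
def gradInner {d : ℕ} (Ω : Set (Pt d)) (u v : Pt d → ℂ) : ℂ :=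
  ∑ i : Fin d, l2Inner Ω (weakPartial Ω i u) (weakPartial Ω i v)

/-- The form `a(u, v) = (∇u, ∇v) - κ² (u, v) + i σ (u, v)` with constant `σ`. -/
def helmholtzForm {d : ℕ} (Ω : Set (Pt d)) (κ σ : ℝ) (u v : Pt d → ℂ) : ℂ :=
  gradInner Ω u v - (κ : ℂ) ^ 2 * l2Inner Ω u v + Complex.I * ((σ : ℂ) * l2Inner Ω u v)

/-- The system matrix, `A_{ji} = a(φᵢ, φⱼ)`. -/
def systemMatrix {d n : ℕ} (Ω : Set (Pt d)) (κ σ : ℝ) (φ : Fin n → Pt d → ℂ) :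
    Matrix (Fin n) (Fin n) ℂ :=
  Matrix.of fun j i => helmholtzForm Ω κ σ (φ i) (φ j)

/-- The stiffness matrix, `K_{ji} = (∇φᵢ, ∇φⱼ)`. -/
def stiffnessMatrix {d n : ℕ} (Ω : Set (Pt d)) (φ : Fin n → Pt d → ℂ) :
    Matrix (Fin n) (Fin n) ℂ :=
  Matrix.of fun j i => gradInner Ω (φ i) (φ j)

/-- The mass matrix, `M_{ji} = (φᵢ, φⱼ)`. -/
def massMatrix {d n : ℕ} (Ω : Set (Pt d)) (φ : Fin n → Pt d → ℂ) :
    Matrix (Fin n) (Fin n) ℂ :=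
  Matrix.of fun j i => l2Inner Ω (φ i) (φ j)

/-- The matrix `A K⁻¹ M` of the system with the exact Laplace preconditioner on the right. -/
def preconditionedMatrix {d n : ℕ} {Ω : Set (Pt d)} {T : Geometry.SimplicialComplex ℝ (Pt d)}
    (κ σ : ℝ) (φ : Module.Basis (Fin n) ℂ (Vh Ω T)) : Matrix (Fin n) (Fin n) ℂ :=
  systemMatrix Ω κ σ (fun i => (φ i : Pt d → ℂ)) *
    (stiffnessMatrix Ω (fun i => (φ i : Pt d → ℂ)))⁻¹ *
    massMatrix Ω (fun i => (φ i : Pt d → ℂ))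

/-! ### Field of values and GMRES -/

/-- The field of values `{x* B x / x* x : x ≠ 0}`. -/
def fieldOfValues {n : ℕ} (B : Matrix (Fin n) (Fin n) ℂ) : Set ℂ :=
  {z | ∃ x : Fin n → ℂ, x ≠ 0 ∧ z = (star x ⬝ᵥ B.mulVec x) / (star x ⬝ᵥ x)}

/-- The Krylov space spanned by `b, B b, …, B^(m-1) b`. -/
def krylovSpace {n : ℕ} (B : Matrix (Fin n) (Fin n) ℂ) (b : EuclideanSpace ℂ (Fin n)) (m : ℕ) :
    Submodule ℂ (EuclideanSpace ℂ (Fin n)) :=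
  Submodule.span ℂ ((fun j : ℕ => Matrix.toEuclideanLin (B ^ j) b) '' Set.Iio m)

/-- `x` is the `m`-th GMRES iterate for `B x = b`: it minimizes the Euclidean norm of the residual
over the `m`-th Krylov space. -/
def IsGMRESIterate {n : ℕ} (B : Matrix (Fin n) (Fin n) ℂ) (b : EuclideanSpace ℂ (Fin n)) (m : ℕ)
    (x : EuclideanSpace ℂ (Fin n)) : Prop :=
  x ∈ krylovSpace B b m ∧
    ∀ y ∈ krylovSpace B b m,
      ‖Matrix.toEuclideanLin B x - b‖ ≤ ‖Matrix.toEuclideanLin B y - b‖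

end HelmholtzFEM

end

/-! Regard the nodal functions as vectors `v i` in L²(Ω) and their gradients as vectors `w i` in
L²(Ω)^d. Then M and K are Gram matrices and A = K + τM with τ = -κ² + iσ, so AK⁻¹M = M + τMK⁻¹M. For
y = K⁻¹Mx this gives x*(AK⁻¹M)x = ‖∑ xᵢvᵢ‖² + τ‖∑ yᵢwᵢ‖². Every point of the field of values is
therefore z = s + τt, with t real and s a Rayleigh quotient of M. Since Re z = s - κ²t and Im z =
σt, the combination Re z + (κ²/σ) Im z equals s. The strip, and the exclusion of 0, thus reduce to
the bounds c h^d ≤ s ≤ C h^d for the mass matrix (`IsQuasiUniform.exists_mass_bounds`).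

For GMRES, multiplication by θ = 1 - iκ²/σ makes θτ purely imaginary, so Re(θz) = s ≥ c h^d. The
Poincaré–Friedrichs inequality (`exists_norm_toL2_le`) bounds MK⁻¹M, hence the norm of AK⁻¹M is at
most a constant times h^d (`norm_preconditioned_le`). Coercivity and norm scale alike in h, so a
Richardson iteration with a suitable step contracts at a rate independent of h, and GMRES does at
least as well in the same Krylov spaces. Poincaré also makes K invertible. -/

open Matrix in
open scoped InnerProductSpace in
/-- Applying `(K + τ M) K⁻¹ M` for Gram matrices `M` and `K`, in weak form. -/
theorem Matrix.star_dotProduct_preconditioned_gram {n H H' : Type*} [Fintype n] [DecidableEq n]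
    [NormedAddCommGroup H] [InnerProductSpace ℂ H] [NormedAddCommGroup H'] [InnerProductSpace ℂ H']
    (v : n → H) (w : n → H') (hw : IsUnit (gram ℂ w).det) (τ : ℂ) (x : n → ℂ) :
    ∃ y : n → ℂ,
      (∀ z : n → ℂ, ⟪∑ i, z i • w i, ∑ i, y i • w i⟫_ℂ = ⟪∑ i, z i • v i, ∑ i, x i • v i⟫_ℂ) ∧
      ∀ z : n → ℂ, star z ⬝ᵥ ((gram ℂ w + τ • gram ℂ v) * (gram ℂ w)⁻¹ * gram ℂ v) *ᵥ x =
        ⟪∑ i, z i • v i, ∑ i, x i • v i⟫_ℂ + τ * ⟪∑ i, z i • v i, ∑ i, y i • v i⟫_ℂ := by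
  have hK : gram ℂ w * (gram ℂ w)⁻¹ = 1 := Matrix.mul_nonsing_inv _ hw
  refine ⟨(gram ℂ w)⁻¹ *ᵥ gram ℂ v *ᵥ x, fun z => ?_, fun z => ?_⟩
  · rw [← star_dotProduct_gram_mulVec, ← star_dotProduct_gram_mulVec, mulVec_mulVec, hK, one_mulVec]
  · rw [← star_dotProduct_gram_mulVec, ← star_dotProduct_gram_mulVec, add_mul, hK, add_mul, one_mul,
      add_mulVec, dotProduct_add, smul_mul_assoc, smul_mul_assoc, smul_mulVec, dotProduct_smul,
      smul_eq_mul, mulVec_mulVec, mulVec_mulVec, Matrix.mul_assoc]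

theorem EuclideanSpace.star_dotProduct_self {n : Type*} [Fintype n] (x : EuclideanSpace ℂ n) :
    star x.ofLp ⬝ᵥ x.ofLp = ((‖x‖ ^ 2 : ℝ) : ℂ) := by
  have := inner_self_eq_norm_sq_to_K (𝕜 := ℂ) x
  rw [EuclideanSpace.inner_eq_star_dotProduct, dotProduct_comm] at this
  simpa using this

/-- Minimal residual step: an operator whose (rotated) numerical range has real part at least `a`
and whose norm is at most `L` admits a uniformly contracting Richardson iteration. -/
theorem norm_sub_smul_sq_le {E : Type*} [NormedAddCommGroup E] [InnerProductSpace ℂ E]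
    {r s : E} {θ : ℂ} {a L : ℝ} (ha : 0 ≤ a) (hL : 0 < L)
    (hre : a * ‖r‖ ^ 2 ≤ (θ * inner ℂ r s).re) (hs : ‖θ‖ * ‖s‖ ≤ L * ‖r‖) :
    ‖r - (((a / L ^ 2 : ℝ) : ℂ) * θ) • s‖ ^ 2 ≤ (1 - (a / L) ^ 2) * ‖r‖ ^ 2 := by
  -- This step length minimizes the bound 1 - 2ta + t²L² on the contraction factor.
  set t : ℝ := a / L ^ 2 with ht
  have ht0 : 0 ≤ t := by positivity
  have h1 : ‖r - ((t : ℂ) * θ) • s‖ ^ 2 =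
      ‖r‖ ^ 2 - 2 * (t * (θ * inner ℂ r s).re) + t ^ 2 * (‖θ‖ * ‖s‖) ^ 2 := by
    rw [@norm_sub_sq ℂ, inner_smul_right, norm_smul, norm_mul, mul_assoc (t : ℂ)]
    simp only [RCLike.re_to_complex, Complex.re_ofReal_mul, Complex.norm_real, Real.norm_eq_abs]
    rw [abs_of_nonneg ht0]
    ring
  have h2 : (‖θ‖ * ‖s‖) ^ 2 ≤ (L * ‖r‖) ^ 2 := by gcongr
  have h3 : t * (a * ‖r‖ ^ 2) ≤ t * (θ * inner ℂ r s).re := by gcongr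
  have h4 : t ^ 2 * (‖θ‖ * ‖s‖) ^ 2 ≤ t ^ 2 * (L * ‖r‖) ^ 2 := by gcongr
  have h5 : t * (a * ‖r‖ ^ 2) = (a / L) ^ 2 * ‖r‖ ^ 2 := by rw [ht]; field_simp
  have h6 : t ^ 2 * (L * ‖r‖) ^ 2 = (a / L) ^ 2 * ‖r‖ ^ 2 := by rw [ht]; field_simp
  linarith

/-! ### GMRES compared with a stationary iteration. -/

namespace HelmholtzFEM

theorem krylovSpace_mono {n : ℕ} (B : Matrix (Fin n) (Fin n) ℂ) (b : EuclideanSpace ℂ (Fin n))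
    {m k : ℕ} (h : m ≤ k) : krylovSpace B b m ≤ krylovSpace B b k :=
  Submodule.span_mono (Set.image_mono (Set.Iio_subset_Iio h))

theorem self_mem_krylovSpace {n : ℕ} (B : Matrix (Fin n) (Fin n) ℂ) (b : EuclideanSpace ℂ (Fin n))
    (m : ℕ) : b ∈ krylovSpace B b (m + 1) :=
  Submodule.subset_span ⟨0, by simp, by simp⟩

theorem apply_mem_krylovSpace {n : ℕ} (B : Matrix (Fin n) (Fin n) ℂ)
    (b : EuclideanSpace ℂ (Fin n)) {m : ℕ} {y : EuclideanSpace ℂ (Fin n)}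
    (hy : y ∈ krylovSpace B b m) : Matrix.toEuclideanLin B y ∈ krylovSpace B b (m + 1) := by
  have h : krylovSpace B b m ≤ (krylovSpace B b (m + 1)).comap (Matrix.toEuclideanLin B) := by
    refine Submodule.span_le.2 ?_
    rintro _ ⟨j, hj, rfl⟩
    refine Submodule.subset_span ⟨j + 1, by simpa using hj, ?_⟩
    simp [Matrix.toLpLin_apply, pow_succ']
  exact h hy

/-- If one step of a stationary Richardson iteration contracts residuals by `ρ`, the residual of the
`m`-th GMRES iterate is at most `ρ ^ m` times the initial one. -/
theorem IsGMRESIterate.norm_residual_le {n : ℕ} {B : Matrix (Fin n) (Fin n) ℂ}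
    {b x : EuclideanSpace ℂ (Fin n)} {m : ℕ} (hx : IsGMRESIterate B b m x) {ρ : ℝ} (hρ : 0 ≤ ρ)
    {α : ℂ} (hα : ∀ r, ‖r - α • Matrix.toEuclideanLin B r‖ ≤ ρ * ‖r‖) :
    ‖Matrix.toEuclideanLin B x - b‖ ≤ ρ ^ m * ‖b‖ := by
  suffices h : ∃ y ∈ krylovSpace B b m, ‖Matrix.toEuclideanLin B y - b‖ ≤ ρ ^ m * ‖b‖ by
    obtain ⟨y, hy, hle⟩ := h
    exact (hx.2 y hy).trans hle
  clear hx
  induction m with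
  | zero => exact ⟨0, zero_mem _, by simp⟩
  | succ m ih =>
    obtain ⟨y, hy, hle⟩ := ih
    have hmem : Matrix.toEuclideanLin B y - b ∈ krylovSpace B b (m + 1) :=
      sub_mem (apply_mem_krylovSpace B b hy) (self_mem_krylovSpace B b m)
    -- The competitor is the Richardson iterate: its correction is a multiple of the residual, which
    -- lies in the next Krylov space.
    refine ⟨y - α • (Matrix.toEuclideanLin B y - b),
      sub_mem (krylovSpace_mono B b m.le_succ hy) (Submodule.smul_mem _ _ hmem), ?_⟩
    have e : Matrix.toEuclideanLin B (y - α • (Matrix.toEuclideanLin B y - b)) - b =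
        (Matrix.toEuclideanLin B y - b) -
          α • Matrix.toEuclideanLin B (Matrix.toEuclideanLin B y - b) := by
      rw [map_sub, map_smul]
      abel
    rw [e, pow_succ', mul_assoc]
    exact (hα _).trans (by gcongr)

/-! ### Preconditioned Gram matrices in abstract inner product spaces. -/

section Gram

open Matrix
open scoped InnerProductSpace

variable {n : ℕ} {H H' : Type*} [NormedAddCommGroup H] [InnerProductSpace ℂ H]
  [NormedAddCommGroup H'] [InnerProductSpace ℂ H'] {v : Fin n → H} {w : Fin n → H'} {a b P : ℝ}

/-- If a combination of the `w i` vanishes, `hP` kills the same combination of the `v i`, and `hlow`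
then kills the coefficients. -/
theorem isUnit_det_gram (ha : 0 < a)
    (hlow : ∀ x : Fin n → ℂ, a * ∑ i, ‖x i‖ ^ 2 ≤ ‖∑ i, x i • v i‖ ^ 2)
    (hP : ∀ x : Fin n → ℂ, ‖∑ i, x i • v i‖ ≤ P * ‖∑ i, x i • w i‖) :
    IsUnit (gram ℂ w).det := by
  rw [isUnit_iff_ne_zero, det_gram_ne_zero_iff_linearIndependent, Fintype.linearIndependent_iff]
  intro x hx i
  have h1 := hP x
  rw [hx, norm_zero, mul_zero] at h1
  have h2 : ‖∑ i, x i • v i‖ = 0 := le_antisymm h1 (norm_nonneg _)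
  have h3 := hlow x
  rw [h2] at h3
  have h4 : ∑ i, ‖x i‖ ^ 2 ≤ 0 := by
    by_contra! h
    have := mul_pos ha h
    linarith
  have h5 := Finset.single_le_sum (f := fun i => ‖x i‖ ^ 2) (fun i _ => by positivity)
    (Finset.mem_univ i)
  have h6 : ‖x i‖ ^ 2 = 0 := le_antisymm (h5.trans h4) (by positivity)
  simpa using h6

/-- Testing the equation Ky = Mx with y shows that x*My = ‖∑ yᵢwᵢ‖² is real, so τ enters with a real
factor. Only its being real matters for the strip. -/
theorem exists_of_mem_fieldOfValues (hw : IsUnit (gram ℂ w).det)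
    (hlow : ∀ x : Fin n → ℂ, a * ∑ i, ‖x i‖ ^ 2 ≤ ‖∑ i, x i • v i‖ ^ 2)
    (hupp : ∀ x : Fin n → ℂ, ‖∑ i, x i • v i‖ ^ 2 ≤ b * ∑ i, ‖x i‖ ^ 2) {τ z : ℂ}
    (hz : z ∈ fieldOfValues ((gram ℂ w + τ • gram ℂ v) * (gram ℂ w)⁻¹ * gram ℂ v)) :
    ∃ s t : ℝ, a ≤ s ∧ s ≤ b ∧ z = s + τ * t := by
  obtain ⟨x, hx, rfl⟩ := hz
  obtain ⟨y, hy, hB⟩ := star_dotProduct_preconditioned_gram v w hw τ x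
  have hN : star x ⬝ᵥ x = ((∑ i, ‖x i‖ ^ 2 : ℝ) : ℂ) := by
    simp [dotProduct, ← Complex.conj_mul']
  have hpos : 0 < ∑ i, ‖x i‖ ^ 2 := by
    obtain ⟨i, hi⟩ := Function.ne_iff.1 hx
    exact Finset.sum_pos' (fun i _ => by positivity)
      ⟨i, Finset.mem_univ i, by have : x i ≠ 0 := hi; positivity⟩
  have hxy : ⟪∑ i, x i • v i, ∑ i, y i • v i⟫_ℂ = ((‖∑ i, y i • w i‖ ^ 2 : ℝ) : ℂ) := by
    rw [← inner_conj_symm, ← hy y, inner_conj_symm, inner_self_eq_norm_sq_to_K]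
    simp
  refine ⟨‖∑ i, x i • v i‖ ^ 2 / ∑ i, ‖x i‖ ^ 2, ‖∑ i, y i • w i‖ ^ 2 / ∑ i, ‖x i‖ ^ 2,
    (le_div_iff₀ hpos).2 (hlow x), (div_le_iff₀ hpos).2 (hupp x), ?_⟩
  rw [hB x, hN, hxy, inner_self_eq_norm_sq_to_K]
  push_cast
  simp only [Complex.coe_algebraMap]
  ring

/-- The rotation by θ makes the τ-term purely imaginary, because its other factor is real; only the
mass term survives in the real part. -/
theorem re_mul_inner_preconditioned_ge (hw : IsUnit (gram ℂ w).det)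
    (hlow : ∀ x : Fin n → ℂ, a * ∑ i, ‖x i‖ ^ 2 ≤ ‖∑ i, x i • v i‖ ^ 2) {τ θ : ℂ}
    (hθ : θ.re = 1) (hτ : (θ * τ).re = 0) (x : EuclideanSpace ℂ (Fin n)) :
    a * ‖x‖ ^ 2 ≤ (θ * ⟪x, Matrix.toEuclideanLin
      ((gram ℂ w + τ • gram ℂ v) * (gram ℂ w)⁻¹ * gram ℂ v) x⟫_ℂ).re := by
  obtain ⟨y, hy, hB⟩ := star_dotProduct_preconditioned_gram v w hw τ x.ofLp
  have hxy : ⟪∑ i, x i • v i, ∑ i, y i • v i⟫_ℂ = ((‖∑ i, y i • w i‖ ^ 2 : ℝ) : ℂ) := by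
    rw [← inner_conj_symm, ← hy y, inner_conj_symm, inner_self_eq_norm_sq_to_K]
    simp
  have hxx : ⟪∑ i, x i • v i, ∑ i, x i • v i⟫_ℂ = ((‖∑ i, x i • v i‖ ^ 2 : ℝ) : ℂ) := by
    rw [inner_self_eq_norm_sq_to_K]
    simp
  rw [EuclideanSpace.inner_eq_star_dotProduct, dotProduct_comm, Matrix.toLpLin_apply, hB, hxx, hxy,
    mul_add, ← mul_assoc, Complex.add_re, Complex.re_mul_ofReal, Complex.re_mul_ofReal, hθ, hτ,
    EuclideanSpace.norm_sq_eq]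
  simpa using hlow x

/-- The vector y solves a discrete Poisson problem with datum ∑ xᵢvᵢ; the energy identity and `hP`
bound ∑ yᵢvᵢ by P² times the datum. Testing the image r of x with r itself leaves two norms of
combinations of the `v i`, each costing √b. -/
theorem norm_preconditioned_le (hw : IsUnit (gram ℂ w).det) (hb : 0 ≤ b)
    (hupp : ∀ x : Fin n → ℂ, ‖∑ i, x i • v i‖ ^ 2 ≤ b * ∑ i, ‖x i‖ ^ 2)
    (hP : ∀ x : Fin n → ℂ, ‖∑ i, x i • v i‖ ≤ P * ‖∑ i, x i • w i‖) (τ : ℂ)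
    (x : EuclideanSpace ℂ (Fin n)) :
    ‖Matrix.toEuclideanLin ((gram ℂ w + τ • gram ℂ v) * (gram ℂ w)⁻¹ * gram ℂ v) x‖ ≤
      (1 + ‖τ‖ * P ^ 2) * b * ‖x‖ := by
  obtain ⟨y, hy, hB⟩ := star_dotProduct_preconditioned_gram v w hw τ x.ofLp
  have hJ (z : EuclideanSpace ℂ (Fin n)) : ‖∑ i, z i • v i‖ ≤ √b * ‖z‖ := by
    refine le_of_sq_le_sq ?_ (by positivity)
    rw [mul_pow, Real.sq_sqrt hb, EuclideanSpace.norm_sq_eq]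
    exact hupp z.ofLp
  have hyx : ‖∑ i, y i • v i‖ ≤ P ^ 2 * ‖∑ i, x i • v i‖ := by
    have h1 : ‖∑ i, y i • w i‖ ^ 2 ≤ ‖∑ i, y i • v i‖ * ‖∑ i, x i • v i‖ := by
      have h := hy y
      rw [inner_self_eq_norm_sq_to_K] at h
      have h' := norm_inner_le_norm (𝕜 := ℂ) (∑ i, y i • v i) (∑ i, x i • v i)
      rw [← h] at h'
      simpa using h'
    have h2 : ‖∑ i, y i • v i‖ ^ 2 ≤ P ^ 2 * ‖∑ i, y i • w i‖ ^ 2 := by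
      rw [← mul_pow]
      gcongr
      exact hP y
    rcases (norm_nonneg (∑ i, y i • v i)).eq_or_lt with h0 | h0
    · rw [← h0]; positivity
    · refine le_of_mul_le_mul_left ?_ h0
      calc ‖∑ i, y i • v i‖ * ‖∑ i, y i • v i‖ = ‖∑ i, y i • v i‖ ^ 2 := by ring
        _ ≤ P ^ 2 * ‖∑ i, y i • w i‖ ^ 2 := h2
        _ ≤ P ^ 2 * (‖∑ i, y i • v i‖ * ‖∑ i, x i • v i‖) := by gcongr
        _ = _ := by ring
  set r := Matrix.toEuclideanLin ((gram ℂ w + τ • gram ℂ v) * (gram ℂ w)⁻¹ * gram ℂ v) x with hr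
  have hrr : ((‖r‖ ^ 2 : ℝ) : ℂ) = ⟪∑ i, r i • v i, ∑ i, x i • v i⟫_ℂ +
      τ * ⟪∑ i, r i • v i, ∑ i, y i • v i⟫_ℂ := by
    rw [← hB r.ofLp, ← EuclideanSpace.star_dotProduct_self r]
    rfl
  have hle : ‖r‖ ^ 2 ≤ ‖r‖ * ((1 + ‖τ‖ * P ^ 2) * b * ‖x‖) :=
    calc ‖r‖ ^ 2 = ‖((‖r‖ ^ 2 : ℝ) : ℂ)‖ := by
          rw [Complex.norm_real, Real.norm_of_nonneg (by positivity)]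
      _ ≤ ‖∑ i, r i • v i‖ * ‖∑ i, x i • v i‖ +
          ‖τ‖ * (‖∑ i, r i • v i‖ * ‖∑ i, y i • v i‖) := by
          rw [hrr]
          refine (norm_add_le _ _).trans ?_
          rw [norm_mul]
          gcongr <;> exact norm_inner_le_norm _ _
      _ ≤ ‖∑ i, r i • v i‖ * ‖∑ i, x i • v i‖ +
          ‖τ‖ * (‖∑ i, r i • v i‖ * (P ^ 2 * ‖∑ i, x i • v i‖)) := by gcongr
      _ = (1 + ‖τ‖ * P ^ 2) * (‖∑ i, r i • v i‖ * ‖∑ i, x i • v i‖) := by ring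
      _ ≤ (1 + ‖τ‖ * P ^ 2) * ((√b * ‖r‖) * (√b * ‖x‖)) := by
          gcongr
          exacts [hJ r, hJ x]
      _ = ‖r‖ * ((1 + ‖τ‖ * P ^ 2) * (√b * √b) * ‖x‖) := by ring
      _ = _ := by rw [Real.mul_self_sqrt hb]
  rcases (norm_nonneg r).eq_or_lt with h0 | h0
  · rw [← h0]; positivity
  · refine le_of_mul_le_mul_left ?_ h0
    rwa [← sq]

end Gram

end HelmholtzFEM

namespace HelmholtzFEM

/-! ### Weak derivatives as linear maps into L². -/

section Sobolev

open scoped ENNReal InnerProductSpace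

variable {d : ℕ} {Ω : Set (Pt d)}

/-- By the fundamental lemma of the calculus of variations, with real test functions read as complex
ones. This uniqueness makes the chosen `weakPartial` linear modulo null sets. -/
theorem HasWeakPartial.ae_eq (hΩ : IsOpen Ω) {i : Fin d} {u g k : Pt d → ℂ}
    (hg : HasWeakPartial Ω i u g) (hk : HasWeakPartial Ω i u k) :
    g =ᵐ[volume.restrict Ω] k := by
  have hgk : MemLp (g - k) 2 (volume.restrict Ω) := hg.1.sub hk.1
  have h := hΩ.ae_eq_zero_of_integral_contDiff_smul_eq_zero (μ := volume) (f := g - k)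
    (locallyIntegrableOn_of_locallyIntegrable_restrict (hgk.locallyIntegrable (by norm_num)))
    (fun η hη hηc hηs => by
      have hψ : IsTestFunction Ω (fun x => (η x : ℂ)) :=
        ⟨Complex.ofRealCLM.contDiff.comp hη, hηc.comp_left Complex.ofReal_zero,
          (tsupport_comp_subset Complex.ofReal_zero η).trans hηs⟩
      have e : (fun x => η x • (g - k) x) = fun x => g x * (η x : ℂ) - k x * (η x : ℂ) := by
        ext x
        simp [mul_comm, mul_sub]
      have hz : ∀ x, x ∉ Ω → η x • (g - k) x = 0 := fun x hx => by
        rw [image_eq_zero_of_notMem_tsupport (fun h => hx (hηs h)), zero_smul]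
      rw [← setIntegral_eq_integral_of_forall_compl_eq_zero hz, e]
      refine (integral_sub (hg.1.integrable_mul hψ.memLp) (hk.1.integrable_mul hψ.memLp)).trans ?_
      simp only [Pi.mul_apply]
      rw [sub_eq_zero, ← neg_inj, ← hg.2 _ hψ, ← hk.2 _ hψ])
  rw [Filter.EventuallyEq, ae_restrict_iff' hΩ.measurableSet]
  filter_upwards [h] with x hx hxΩ
  exact sub_eq_zero.1 (hx hxΩ)

theorem HasWeakPartial.weakPartial {i : Fin d} {u g : Pt d → ℂ}
    (hg : HasWeakPartial Ω i u g) : HasWeakPartial Ω i u (weakPartial Ω i u) := by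
  have h : ∃ g, HasWeakPartial Ω i u g := ⟨g, hg⟩
  rw [HelmholtzFEM.weakPartial, dif_pos h]
  exact Classical.choose_spec h

theorem MemH10.hasWeakPartial {u : Pt d → ℂ} (hu : MemH10 Ω u) (i : Fin d) :
    HasWeakPartial Ω i u (weakPartial Ω i u) := by
  obtain ⟨-, g, hg, -⟩ := hu
  exact (hg i).weakPartial

/-- The embedding of `H¹₀(Ω)` into `L²(Ω)`. -/
noncomputable def toL2 (Ω : Set (Pt d)) : H10 Ω →ₗ[ℂ] Lp ℂ 2 (volume.restrict Ω) where
  toFun u := MemLp.toLp u.1 u.2.1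
  map_add' u v := MemLp.toLp_add u.2.1 v.2.1
  map_smul' c u := MemLp.toLp_const_smul c u.2.1

/-- The weak partial derivative as a linear map from `H¹₀(Ω)` to `L²(Ω)`. -/
noncomputable def partialL2 (hΩ : IsOpen Ω) (i : Fin d) : H10 Ω →ₗ[ℂ] Lp ℂ 2 (volume.restrict Ω) where
  toFun u := MemLp.toLp (weakPartial Ω i u.1) (MemH10.hasWeakPartial u.2 i).1
  map_add' u v := by
    rw [← MemLp.toLp_add, MemLp.toLp_eq_toLp_iff]
    exact (MemH10.hasWeakPartial (u + v).2 i).ae_eq hΩ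
      ((MemH10.hasWeakPartial u.2 i).add u.2.1 v.2.1 (MemH10.hasWeakPartial v.2 i))
  map_smul' c u := by
    rw [RingHom.id_apply, ← MemLp.toLp_const_smul, MemLp.toLp_eq_toLp_iff]
    exact (MemH10.hasWeakPartial (c • u).2 i).ae_eq hΩ ((MemH10.hasWeakPartial u.2 i).smul c)

/-- The weak gradient as a linear map from `H¹₀(Ω)` to `L²(Ω)^d`. -/
noncomputable def gradL2 (hΩ : IsOpen Ω) :
    H10 Ω →ₗ[ℂ] PiLp 2 fun _ : Fin d => Lp ℂ 2 (volume.restrict Ω) :=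
  (WithLp.linearEquiv 2 ℂ _).symm.toLinearMap ∘ₗ LinearMap.pi (partialL2 hΩ)

/-- The arguments swap because Mathlib's inner product is antilinear in the first slot; this matches
the index order ji of the matrices. -/
theorem inner_toLp (u v : Pt d → ℂ) (hu : MemLp u 2 (volume.restrict Ω))
    (hv : MemLp v 2 (volume.restrict Ω)) : ⟪hv.toLp v, hu.toLp u⟫_ℂ = l2Inner Ω u v := by
  rw [L2.inner_def, l2Inner]
  refine integral_congr_ae ?_
  filter_upwards [hu.coeFn_toLp, hv.coeFn_toLp] with x hx hy
  rw [hx, hy, RCLike.inner_apply]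

theorem inner_toL2 (u v : H10 Ω) : ⟪toL2 Ω v, toL2 Ω u⟫_ℂ = l2Inner Ω u v :=
  inner_toLp _ _ u.2.1 v.2.1

theorem inner_gradL2 (hΩ : IsOpen Ω) (u v : H10 Ω) :
    ⟪gradL2 hΩ v, gradL2 hΩ u⟫_ℂ = gradInner Ω u v := by
  rw [PiLp.inner_apply, gradInner]
  exact Finset.sum_congr rfl fun i _ =>
    inner_toLp _ _ (MemH10.hasWeakPartial u.2 i).1 (MemH10.hasWeakPartial v.2 i).1

theorem norm_toL2_sq (u : H10 Ω) : ‖toL2 Ω u‖ ^ 2 = ∫ x in Ω, ‖(u : Pt d → ℂ) x‖ ^ 2 := by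
  have h := inner_self_eq_norm_sq_to_K (𝕜 := ℂ) (toL2 Ω u)
  rw [inner_toL2, l2Inner] at h
  have e : ∀ x, (u : Pt d → ℂ) x * conj ((u : Pt d → ℂ) x) =
      ((‖(u : Pt d → ℂ) x‖ ^ 2 : ℝ) : ℂ) := fun x => by
    rw [Complex.mul_conj']
    push_cast
    rfl
  simp only [e] at h
  rw [integral_complex_ofReal] at h
  exact Complex.ofReal_injective (by simpa using h.symm)

/-! ### The Poincaré–Friedrichs inequality -/

theorem norm_fderiv_le_sum (ψ : Pt d → ℂ) (x : Pt d) :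
    ‖fderiv ℝ ψ x‖ ≤ ∑ i, ‖classicalPartial i ψ x‖ := by
  refine ContinuousLinearMap.opNorm_le_bound _ (Finset.sum_nonneg fun _ _ => norm_nonneg _)
    fun v => ?_
  have hv : v = ∑ i, v i • EuclideanSpace.single i (1 : ℝ) := by
    ext j
    simp [Finset.sum_apply, Pi.single_apply]
  calc ‖fderiv ℝ ψ x v‖ = ‖∑ i, v i • classicalPartial i ψ x‖ := by
        conv_lhs => rw [hv]
        simp [classicalPartial]
    _ ≤ ∑ i, ‖v i • classicalPartial i ψ x‖ := norm_sum_le _ _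
    _ ≤ ∑ i, ‖classicalPartial i ψ x‖ * ‖v‖ := by
        refine Finset.sum_le_sum fun i _ => ?_
        rw [norm_smul, mul_comm]
        gcongr
        exact PiLp.norm_apply_le v i
    _ = _ := (Finset.sum_mul _ _ _).symm

/-- Gagliardo–Nirenberg–Sobolev from L^{3/2} gradients to L², then Hölder on the bounded set Ω. -/
theorem IsTestFunction.exists_eLpNorm_le (hd : d = 2 ∨ d = 3) (hΩ : Bornology.IsBounded Ω) :
    ∃ C : ℝ≥0∞, C ≠ ⊤ ∧ ∀ ψ : Pt d → ℂ, IsTestFunction Ω ψ →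
      eLpNorm ψ 2 (volume.restrict Ω) ≤
        C * ∑ i, eLpNorm (classicalPartial i ψ) 2 (volume.restrict Ω) := by
  -- The exponent p = 3/2 satisfies p < d, which p = 2 does not when d = 2, and 1/p - 1/d ≤ 1/2 in
  -- both dimensions.
  let C₀ : NNReal := eLpNormLESNormFDerivOfLeConst ℂ (volume : Measure (Pt d)) Ω (3 / 2) 2
  let e : ℝ := 1 / ((3 / 2 : NNReal) : ℝ≥0∞).toReal - 1 / (2 : ℝ≥0∞).toReal
  have he : 0 ≤ e := by simp only [e]; norm_num
  refine ⟨C₀ * volume Ω ^ e, ENNReal.mul_ne_top ENNReal.coe_ne_top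
    (ENNReal.rpow_ne_top_of_nonneg he hΩ.measure_lt_top.ne), fun ψ hψ => ?_⟩
  have hsupp : ψ.support ⊆ Ω := (subset_tsupport ψ).trans hψ.tsupport_subset
  have hsupp' : (fderiv ℝ ψ).support ⊆ Ω :=
    (support_fderiv_subset ℝ).trans hψ.tsupport_subset
  have hGNS : eLpNorm ψ 2 volume ≤ C₀ * eLpNorm (fderiv ℝ ψ) (3 / 2 : NNReal) volume := by
    have h32 : ((3 / 2 : NNReal) : ℝ) = 3 / 2 := by norm_num
    have := eLpNorm_le_eLpNorm_fderiv_of_le (volume : Measure (Pt d)) (u := ψ) (s := Ω)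
      (p := 3 / 2) (q := 2) (hψ.contDiff.of_le (by simp)) hsupp
      (by rw [← NNReal.coe_le_coe]; norm_num)
      (by rw [finrank_euclideanSpace_fin, ← NNReal.coe_lt_coe]
          rcases hd with rfl | rfl <;> norm_num)
      (by rw [finrank_euclideanSpace_fin]
          rcases hd with rfl | rfl <;> norm_num) hΩ
    simpa using this
  calc eLpNorm ψ 2 (volume.restrict Ω) ≤ eLpNorm ψ 2 volume :=
        eLpNorm_mono_measure _ Measure.restrict_le_self
    _ ≤ C₀ * eLpNorm (fderiv ℝ ψ) (3 / 2 : NNReal) (volume.restrict Ω) := by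
        rwa [← eLpNorm_norm (fderiv ℝ ψ), eLpNorm_restrict_eq_of_support_subset
          (fun x hx => hsupp' (norm_ne_zero_iff.1 hx)), eLpNorm_norm]
    _ ≤ C₀ * (eLpNorm (fderiv ℝ ψ) 2 (volume.restrict Ω) * volume Ω ^ e) := by
        gcongr
        have h := eLpNorm_le_eLpNorm_mul_rpow_measure_univ (μ := volume.restrict Ω)
          (f := fderiv ℝ ψ) (p := (3 / 2 : NNReal)) (q := 2)
          (by rw [← ENNReal.coe_ofNat, ENNReal.coe_le_coe, ← NNReal.coe_le_coe]; norm_num)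
          (hψ.contDiff.continuous_fderiv (by simp)).aestronglyMeasurable
        rwa [Measure.restrict_apply_univ] at h
    _ ≤ C₀ * ((∑ i, eLpNorm (classicalPartial i ψ) 2 (volume.restrict Ω)) * volume Ω ^ e) := by
        gcongr
        calc eLpNorm (fderiv ℝ ψ) 2 (volume.restrict Ω)
            ≤ eLpNorm (∑ i, fun x => ‖classicalPartial i ψ x‖) 2 (volume.restrict Ω) :=
              eLpNorm_mono_real fun x => by simpa using norm_fderiv_le_sum ψ x
          _ ≤ ∑ i, eLpNorm (fun x => ‖classicalPartial i ψ x‖) 2 (volume.restrict Ω) :=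
              eLpNorm_sum_le (fun i _ => (hψ.memLp_partial i).1.norm) (by norm_num)
          _ = _ := by simp only [eLpNorm_norm]
    _ = _ := by ring

theorem exists_norm_toL2_le (hd : d = 2 ∨ d = 3) (hΩ : IsOpen Ω) (hb : Bornology.IsBounded Ω) :
    ∃ P : ℝ, ∀ u : H10 Ω, ‖toL2 Ω u‖ ≤ P * ‖gradL2 hΩ u‖ := by
  obtain ⟨C, hC, h⟩ := IsTestFunction.exists_eLpNorm_le hd hb
  set μ := volume.restrict Ω
  refine ⟨C.toReal * d, fun u => ?_⟩
  obtain ⟨hu, g, hg, ψ, hψ, hψ₀, hψ₁⟩ := u.2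
  have key : eLpNorm u.1 2 μ ≤ C * ∑ i, eLpNorm (g i) 2 μ := by
    -- The triangle inequality, applied to u and to each gradient component, bounds the norm of u by
    -- this sequence for every m; its limit is the claim.
    have hlim : Tendsto (fun m => eLpNorm (u.1 - ψ m) 2 μ +
        C * ∑ i, (eLpNorm (g i - classicalPartial i (ψ m)) 2 μ + eLpNorm (g i) 2 μ)) atTop
        (𝓝 (0 + C * ∑ i, (0 + eLpNorm (g i) 2 μ))) :=
      hψ₀.add (ENNReal.Tendsto.const_mul
        (tendsto_finsetSum _ fun i _ => (hψ₁ i).add tendsto_const_nhds) (Or.inr hC))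
    simp only [zero_add] at hlim
    refine ge_of_tendsto' hlim fun m => ?_
    have h1 : eLpNorm u.1 2 μ ≤ eLpNorm (u.1 - ψ m) 2 μ + eLpNorm (ψ m) 2 μ := by
      conv_lhs => rw [← sub_add_cancel u.1 (ψ m)]
      exact eLpNorm_add_le (hu.sub (hψ m).memLp).1 (hψ m).memLp.1 (by norm_num)
    refine h1.trans ?_
    gcongr
    refine (h _ (hψ m)).trans ?_
    gcongr with i
    have e : classicalPartial i (ψ m) = -(g i - classicalPartial i (ψ m)) + g i := by abel
    conv_lhs => rw [e]
    refine (eLpNorm_add_le ((hg i).1.sub ((hψ m).memLp_partial i)).neg.1 (hg i).1.1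
      (by norm_num)).trans ?_
    rw [eLpNorm_neg]
  have key' : eLpNorm u.1 2 μ ≤ C * ∑ i, eLpNorm (weakPartial Ω i u.1) 2 μ := by
    refine key.trans_eq ?_
    congr 1
    exact Finset.sum_congr rfl fun i _ =>
      eLpNorm_congr_ae ((hg i).ae_eq hΩ (hg i).weakPartial)
  have hfin : ∀ i, eLpNorm (weakPartial Ω i u.1) 2 μ ≠ ⊤ := fun i =>
    (hg i).weakPartial.1.eLpNorm_ne_top
  have hnorm : ‖toL2 Ω u‖ ≤ C.toReal * ∑ i, ‖partialL2 hΩ i u‖ := by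
    have e1 : ‖toL2 Ω u‖ = (eLpNorm u.1 2 μ).toReal := Lp.norm_toLp u.1 hu
    have e2 : ∀ i, ‖partialL2 hΩ i u‖ = (eLpNorm (weakPartial Ω i u.1) 2 μ).toReal := fun i =>
      Lp.norm_toLp _ (hg i).weakPartial.1
    simp only [e1, e2]
    rw [← ENNReal.toReal_sum fun i _ => hfin i, ← ENNReal.toReal_mul]
    exact ENNReal.toReal_mono (ENNReal.mul_ne_top hC (ENNReal.sum_ne_top.2 fun i _ => hfin i)) key'
  calc ‖toL2 Ω u‖ ≤ C.toReal * ∑ i, ‖partialL2 hΩ i u‖ := hnorm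
    _ ≤ C.toReal * ∑ _i : Fin d, ‖gradL2 hΩ u‖ := by
        gcongr with i
        exact PiLp.norm_apply_le (gradL2 hΩ u) i
    _ = _ := by simp [mul_assoc]

end Sobolev

end HelmholtzFEM

/-- Almost-everywhere disjointness is what closed cells with common faces satisfy. -/
theorem MeasureTheory.setIntegral_biUnion_finset_of_aedisjoint {α ι : Type*} [MeasurableSpace α]
    {μ : Measure α} {f : α → ℝ} (t : Finset ι) {s : ι → Set α}
    (hs : ∀ i ∈ t, MeasurableSet (s i)) (hd : (t : Set ι).Pairwise (Function.onFun (AEDisjoint μ) s))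
    (hf : ∀ i ∈ t, IntegrableOn f (s i) μ) :
    ∫ x in ⋃ i ∈ t, s i, f x ∂μ = ∑ i ∈ t, ∫ x in s i, f x ∂μ := by
  classical
  induction t using Finset.induction_on with
  | empty => simp
  | insert a t ha ih =>
    simp only [Finset.forall_mem_insert] at hs hf
    rw [Finset.coe_insert, Set.pairwise_insert] at hd
    rw [Finset.set_biUnion_insert, setIntegral_union₀ _ _ hf.1 _, Finset.sum_insert ha,
      ih hs.2 hd.1 hf.2]
    · rw [AEDisjoint, Set.inter_iUnion₂]
      exact (measure_biUnion_null_iff t.countable_toSet).2 fun i hi =>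
        (hd.2 i hi (fun h => ha (h ▸ hi))).1
    · exact (Finset.measurableSet_biUnion t hs.2).nullMeasurableSet
    · exact integrableOn_finset_iUnion.2 hf.2

namespace HelmholtzFEM

/-! ### Affine functions on one cell: vertex values against the mean square. -/

section Affine

variable {d : ℕ}

/-- A vertex value of an affine function on a convex set is controlled by the mean square. -/
theorem measureReal_mul_norm_sq_le {D : Set (Pt d)} (hD : IsCompact D) (hc : Convex ℝ D) {v : Pt d}
    (hv : v ∈ D) (p : Pt d →ᵃ[ℝ] ℂ) :
    volume.real D * ‖p v‖ ^ 2 ≤ (8 * 2 ^ d + 2) * ∫ x in D, ‖p x‖ ^ 2 := by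
  have hp : Continuous p := p.continuous_of_finiteDimensional
  set g : Pt d → ℝ := D.indicator fun x => ‖p x‖ ^ 2 with hg
  have hg0 : ∀ x, 0 ≤ g x := fun x => Set.indicator_nonneg (fun x _ => by positivity) x
  have hgi : Integrable g :=
    ((hp.norm.pow 2).continuousOn.integrableOn_compact hD).integrable_indicator hD.measurableSet
  have hgs : Integrable fun z => g ((1 / 2 : ℝ) • z) := hgi.comp_smul (by norm_num)
  have hgm : Integrable fun y => g ((1 / 2 : ℝ) • (v + y)) := hgs.comp_add_left v
  -- The contraction of ratio 1/2 towards v has Jacobian 2^{-d}.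
  have hint : ∫ y, g ((1 / 2 : ℝ) • (v + y)) = 2 ^ d * ∫ y, g y := by
    rw [integral_add_left_eq_self (μ := volume) (fun z => g ((1 / 2 : ℝ) • z)) v,
      Measure.integral_comp_smul, finrank_euclideanSpace_fin, smul_eq_mul,
      abs_of_nonneg (by positivity)]
    congr 1
    rw [one_div, inv_pow, inv_inv]
  -- Affinity gives p(v) = 2p(m) - p(y) at the midpoint m of v and y, which stays in D by convexity;
  -- then (2a + b)² ≤ 8a² + 2b². No reference element is needed.
  have hpt : ∀ y, D.indicator (fun _ => ‖p v‖ ^ 2) y ≤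
      8 * g ((1 / 2 : ℝ) • (v + y)) + 2 * g y := by
    intro y
    by_cases hy : y ∈ D
    · have hm : (1 / 2 : ℝ) • (v + y) = midpoint ℝ v y := by
        rw [midpoint_eq_smul_add, invOf_eq_inv, one_div]
      have hmD : midpoint ℝ v y ∈ D := hc.midpoint_mem hv hy
      rw [hm, hg, Set.indicator_of_mem hy, Set.indicator_of_mem hy, Set.indicator_of_mem hmD,
        AffineMap.map_midpoint]
      have e : p v = (2 : ℝ) • midpoint ℝ (p v) (p y) - p y := by
        rw [midpoint_eq_smul_add, smul_smul, mul_invOf_self, one_smul, add_sub_cancel_right]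
      have h1 : ‖p v‖ ≤ 2 * ‖midpoint ℝ (p v) (p y)‖ + ‖p y‖ := by
        conv_lhs => rw [e]
        refine (norm_sub_le _ _).trans_eq ?_
        rw [norm_smul, Real.norm_ofNat]
      have h2 := pow_le_pow_left₀ (norm_nonneg _) h1 2
      nlinarith [sq_nonneg (2 * ‖midpoint ℝ (p v) (p y)‖ - ‖p y‖)]
    · rw [Set.indicator_of_notMem hy]
      have := hg0 ((1 / 2 : ℝ) • (v + y))
      have := hg0 y
      positivity
  calc volume.real D * ‖p v‖ ^ 2 = ∫ y, D.indicator (fun _ => ‖p v‖ ^ 2) y := by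
        rw [integral_indicator hD.measurableSet, setIntegral_const, smul_eq_mul]
    _ ≤ ∫ y, (8 * g ((1 / 2 : ℝ) • (v + y)) + 2 * g y) :=
        integral_mono ((integrableOn_const hD.measure_lt_top.ne).integrable_indicator
          hD.measurableSet) ((hgm.const_mul 8).add (hgi.const_mul 2)) hpt
    _ = (8 * 2 ^ d + 2) * ∫ y, g y := by
        rw [integral_add (hgm.const_mul 8) (hgi.const_mul 2), integral_const_mul,
          integral_const_mul, hint]
        ring
    _ = _ := by rw [hg, integral_indicator hD.measurableSet]

/-- The mean square of an affine function on a simplex is controlled by its vertex values. -/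
theorem setIntegral_norm_sq_le_sum (s : Finset (Pt d)) (p : Pt d →ᵃ[ℝ] ℂ) :
    ∫ x in convexHull ℝ (s : Set (Pt d)), ‖p x‖ ^ 2 ≤
      ∑ v ∈ s, ‖p v‖ ^ 2 * volume.real (convexHull ℝ (s : Set (Pt d))) := by
  have hD : IsCompact (convexHull ℝ (s : Set (Pt d))) := s.finite_toSet.isCompact_convexHull ℝ
  have hp : Continuous p := p.continuous_of_finiteDimensional
  rw [← Finset.sum_mul, mul_comm, ← smul_eq_mul, ← setIntegral_const]
  refine setIntegral_mono_on ((hp.norm.pow 2).continuousOn.integrableOn_compact hD)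
    (integrableOn_const hD.measure_lt_top.ne) hD.measurableSet fun x hx => ?_
  -- A convex function on a simplex is dominated by its value at some vertex.
  have hconv : ConvexOn ℝ Set.univ fun x => ‖p x‖ :=
    (convexOn_univ_norm (E := ℂ)).comp_affineMap p
  obtain ⟨v, hv, hle⟩ := hconv.exists_ge_of_mem_convexHull (Set.subset_univ _) hx
  calc ‖p x‖ ^ 2 ≤ ‖p v‖ ^ 2 := by gcongr
    _ ≤ _ := Finset.single_le_sum (f := fun v => ‖p v‖ ^ 2) (fun _ _ => by positivity) hv

end Affine

/-! ### From cells to the mass matrix of a mesh. -/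

section Mesh

variable {d : ℕ} {Ω : Set (Pt d)} {T : Geometry.SimplicialComplex ℝ (Pt d)}

theorem isCompact_cell (s : Finset (Pt d)) : IsCompact (convexHull ℝ (s : Set (Pt d))) :=
  s.finite_toSet.isCompact_convexHull ℝ

theorem IsTriangulation.finite_cells (hT : IsTriangulation Ω T) : (cells T).Finite :=
  hT.finite.subset fun _ hs => hs.1

theorem IsTriangulation.closure_eq (hT : IsTriangulation Ω T) :
    closure Ω = ⋃ s ∈ hT.finite_cells.toFinset, convexHull ℝ (s : Set (Pt d)) := by
  rw [← hT.space_eq]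
  ext x
  simp only [Geometry.SimplicialComplex.mem_space_iff, Set.mem_iUnion, Set.Finite.mem_toFinset,
    exists_prop]
  constructor
  · rintro ⟨s, hs, hx⟩
    obtain ⟨t, ht, hst⟩ := hT.pure s hs
    exact ⟨t, ht, convexHull_mono (by exact_mod_cast hst) hx⟩
  · rintro ⟨s, hs, hx⟩
    exact ⟨s, hs.1, hx⟩

/-- Distinct cells have equally many vertices, so s has a vertex v outside t. The intersection lies
in the hull of the common vertices, hence in the span of the facet of s opposite v, a proper affine
subspace and so a null set. -/
theorem aedisjoint_cells :
    (cells T).Pairwise (Function.onFun (AEDisjoint (volume : Measure (Pt d)))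
      fun s => convexHull ℝ (s : Set (Pt d))) := by
  intro s hs t ht hst
  obtain ⟨v, hvs, hvt⟩ : ∃ v ∈ s, v ∉ t := by
    by_contra! h
    exact hst (Finset.eq_of_subset_of_card_le h (by rw [hs.2, ht.2]))
  have hv := (T.indep hs.1).notMem_affineSpan_sdiff ⟨v, hvs⟩ Set.univ
  set S := affineSpan ℝ ((↑) '' (Set.univ \ {(⟨v, hvs⟩ : s)}) : Set (Pt d)) with hS
  have hne : S ≠ ⊤ := fun h => hv (by rw [h]; exact AffineSubspace.mem_top ℝ _ _)
  refine measure_mono_null ?_ (Measure.addHaar_affineSubspace volume S hne)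
  refine (T.inter_subset_convexHull hs.1 ht.1).trans ((convexHull_subset_affineSpan _).trans
    (affineSpan_mono ℝ fun x hx => ⟨⟨x, hx.1⟩, ⟨trivial, fun h => hvt ?_⟩, rfl⟩))
  have : x = v := congrArg Subtype.val h
  exact this ▸ hx.2

theorem IsTriangulation.diam_le (hT : IsTriangulation Ω T) {s : Finset (Pt d)} (hs : s ∈ cells T) :
    Metric.diam (convexHull ℝ (s : Set (Pt d))) ≤ meshSize T :=
  le_csSup (hT.finite_cells.image _).bddAbove ⟨s, hs, rfl⟩

theorem IsTriangulation.meshSize_pos (hT : IsTriangulation Ω T) (hd : 0 < d) (hΩ : Ω.Nonempty) :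
    0 < meshSize T := by
  obtain ⟨x, hx⟩ := hΩ
  have hx' := subset_closure hx
  rw [hT.closure_eq] at hx'
  simp only [Set.mem_iUnion, Set.Finite.mem_toFinset] at hx'
  obtain ⟨s, hs, -⟩ := hx'
  have hcard : 1 < s.card := by rw [hs.2]; omega
  obtain ⟨a, ha, b, hb, hab⟩ := Finset.one_lt_card.1 hcard
  calc 0 < dist a b := dist_pos.2 hab
    _ ≤ Metric.diam (convexHull ℝ (s : Set (Pt d))) :=
      Metric.dist_le_diam_of_mem (isCompact_cell s).isBounded (subset_convexHull ℝ _ ha)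
        (subset_convexHull ℝ _ hb)
    _ ≤ _ := hT.diam_le hs

theorem IsTriangulation.integrableOn_cell {u : Pt d → ℂ} (hu : u ∈ Vh Ω T) {s : Finset (Pt d)}
    (hs : s ∈ cells T) :
    IntegrableOn (fun x => ‖u x‖ ^ 2) (convexHull ℝ (s : Set (Pt d))) volume := by
  obtain ⟨p, hp⟩ := hu.2.2 s hs
  refine IntegrableOn.congr_fun (f := fun x => ‖p x‖ ^ 2)
    ((p.continuous_of_finiteDimensional.norm.pow 2).continuousOn.integrableOn_compact
      (isCompact_cell s)) (fun x hx => ?_) (isCompact_cell s).measurableSet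
  simp only [hp hx]

/-- The cells fill the closure of Ω, but u vanishes off Ω, so the measure of the boundary plays no
role. -/
theorem IsTriangulation.setIntegral_eq_sum (hT : IsTriangulation Ω T) {u : Pt d → ℂ}
    (hu : u ∈ Vh Ω T) :
    ∫ x in Ω, ‖u x‖ ^ 2 =
      ∑ s ∈ hT.finite_cells.toFinset, ∫ x in convexHull ℝ (s : Set (Pt d)), ‖u x‖ ^ 2 := by
  rw [← setIntegral_biUnion_finset_of_aedisjoint _
    (fun s _ => (isCompact_cell s).measurableSet) (by simpa using aedisjoint_cells)
    (fun s hs => integrableOn_cell hu (by simpa using hs)), ← hT.closure_eq,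
    setIntegral_eq_integral_of_forall_compl_eq_zero (fun x hx => by simp [hu.2.1 x hx]),
    setIntegral_eq_integral_of_forall_compl_eq_zero
      (fun x hx => by simp [hu.2.1 x fun h => hx (subset_closure h)])]

/-- The cells at v are almost disjoint and lie within distance h of v. Comparing volumes avoids
counting them. -/
theorem IsTriangulation.sum_measureReal_le (hT : IsTriangulation Ω T) (v : Pt d) :
    ∑ s ∈ hT.finite_cells.toFinset with v ∈ s, volume.real (convexHull ℝ (s : Set (Pt d))) ≤
      volume.real (Metric.closedBall v (meshSize T)) := by
  have h := setIntegral_biUnion_finset_of_aedisjoint (μ := volume) (f := fun _ => (1 : ℝ))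
    (hT.finite_cells.toFinset.filter (v ∈ ·)) (s := fun s => convexHull ℝ (s : Set (Pt d)))
    (fun s _ => (isCompact_cell s).measurableSet)
    (aedisjoint_cells.mono fun s hs => by simpa using (Finset.mem_filter.1 hs).1)
    (fun s _ => integrableOn_const (isCompact_cell s).measure_lt_top.ne)
  simp only [setIntegral_const, smul_eq_mul, mul_one] at h
  rw [← h]
  refine measureReal_mono (Set.iUnion₂_subset fun s hs x hx => ?_)
    (isCompact_closedBall v _).measure_lt_top.ne
  rw [Finset.mem_filter, Set.Finite.mem_toFinset] at hs
  exact (Metric.dist_le_diam_of_mem (isCompact_cell s).isBounded hx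
    (subset_convexHull ℝ _ hs.2)).trans (hT.diam_le hs.1)

theorem sum_basis_apply {n : ℕ} {φ : Module.Basis (Fin n) ℂ (Vh Ω T)} {p : Fin n → Pt d}
    (hp : ∀ i j, (φ i : Pt d → ℂ) (p j) = if i = j then 1 else 0) (x : Fin n → ℂ) (j : Fin n) :
    ((∑ i, x i • φ i : Vh Ω T) : Pt d → ℂ) (p j) = x j := by
  simp [Finset.sum_apply, hp]

/-- Upper bound for the mass matrix. -/
theorem IsNodalBasis.setIntegral_norm_sq_le (hT : IsTriangulation Ω T) {n : ℕ}
    {φ : Module.Basis (Fin n) ℂ (Vh Ω T)} (hφ : IsNodalBasis φ) (x : Fin n → ℂ) :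
    ∫ y in Ω, ‖((∑ i, x i • φ i : Vh Ω T) : Pt d → ℂ) y‖ ^ 2 ≤
      volume.real (Metric.closedBall (0 : Pt d) (meshSize T)) * ∑ i, ‖x i‖ ^ 2 := by
  classical
  obtain ⟨p, hinj, hrange, hp⟩ := hφ
  set u : Vh Ω T := ∑ i, x i • φ i with hu
  have hux : ∀ j, (u : Pt d → ℂ) (p j) = x j := sum_basis_apply hp x
  have hvert : ∀ s ∈ cells T, ∑ v ∈ s, ‖(u : Pt d → ℂ) v‖ ^ 2 =
      ∑ j with p j ∈ s, ‖x j‖ ^ 2 := fun s hs => by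
    rw [← Finset.sum_subset (s₁ := (Finset.univ.filter (p · ∈ s)).image p) (s₂ := s),
      Finset.sum_image hinj.injOn]
    · simp only [hux]
    · intro v hv
      obtain ⟨j, hj, rfl⟩ := Finset.mem_image.1 hv
      exact (Finset.mem_filter.1 hj).2
    · intro v hv hv'
      -- A vertex of the cell lying in Ω is a node; at any other vertex u is zero.
      by_cases hvΩ : v ∈ Ω
      · have hvT : v ∈ T.vertices := T.down_closed hs.1 (by simpa using hv) (by simp)
        obtain ⟨j, rfl⟩ : v ∈ Set.range p := hrange ▸ ⟨hvT, hvΩ⟩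
        exact absurd (Finset.mem_image_of_mem p (by simpa using hv)) hv'
      · simp [u.2.2.1 v hvΩ]
  rw [hT.setIntegral_eq_sum u.2]
  calc ∑ s ∈ hT.finite_cells.toFinset, ∫ y in convexHull ℝ (s : Set (Pt d)),
          ‖(u : Pt d → ℂ) y‖ ^ 2
      ≤ ∑ s ∈ hT.finite_cells.toFinset, ∑ j, if p j ∈ s then
          ‖x j‖ ^ 2 * volume.real (convexHull ℝ (s : Set (Pt d))) else 0 := by
        refine Finset.sum_le_sum fun s hs => ?_
        rw [Set.Finite.mem_toFinset] at hs
        obtain ⟨q, hq⟩ := u.2.2.2 s hs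
        rw [← Finset.sum_filter, ← Finset.sum_mul, ← hvert s hs,
          setIntegral_congr_fun (g := fun y => ‖q y‖ ^ 2) (isCompact_cell s).measurableSet
            (fun y hy => by simp only [hq hy])]
        refine (setIntegral_norm_sq_le_sum s q).trans_eq ?_
        rw [Finset.sum_mul]
        exact Finset.sum_congr rfl fun v hv => by rw [hq (subset_convexHull ℝ _ hv)]
    _ = ∑ j, ‖x j‖ ^ 2 * ∑ s ∈ hT.finite_cells.toFinset with p j ∈ s,
          volume.real (convexHull ℝ (s : Set (Pt d))) := by
        rw [Finset.sum_comm]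
        exact Finset.sum_congr rfl fun j _ => by rw [← Finset.sum_filter, Finset.mul_sum]
    _ ≤ ∑ j, ‖x j‖ ^ 2 * volume.real (Metric.closedBall (0 : Pt d) (meshSize T)) := by
        gcongr with j
        refine (hT.sum_measureReal_le (p j)).trans_eq ?_
        rw [measureReal_def, measureReal_def, Measure.addHaar_closedBall_center]
    _ = _ := by rw [← Finset.sum_mul, mul_comm]

/-- Lower bound for the mass matrix. -/
theorem IsNodalBasis.le_setIntegral_norm_sq (hT : IsTriangulation Ω T) {n : ℕ}
    {φ : Module.Basis (Fin n) ℂ (Vh Ω T)} (hφ : IsNodalBasis φ) {m : ℝ}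
    (hm : ∀ s ∈ cells T, m ≤ volume.real (convexHull ℝ (s : Set (Pt d)))) (x : Fin n → ℂ) :
    m * ∑ i, ‖x i‖ ^ 2 ≤ (d + 1) * (8 * 2 ^ d + 2) *
      ∫ y in Ω, ‖((∑ i, x i • φ i : Vh Ω T) : Pt d → ℂ) y‖ ^ 2 := by
  classical
  obtain ⟨p, hinj, hrange, hp⟩ := hφ
  set u : Vh Ω T := ∑ i, x i • φ i with hu
  have hux : ∀ j, (u : Pt d → ℂ) (p j) = x j := sum_basis_apply hp x
  set I : Finset (Pt d) → ℝ := fun s =>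
    ∫ y in convexHull ℝ (s : Set (Pt d)), ‖(u : Pt d → ℂ) y‖ ^ 2 with hI
  have hI0 : ∀ s, 0 ≤ I s := fun s => integral_nonneg fun _ => by positivity
  have hloc : ∀ s ∈ cells T, ∀ j, p j ∈ s → m * ‖x j‖ ^ 2 ≤ (8 * 2 ^ d + 2) * I s := by
    intro s hs j hj
    obtain ⟨q, hq⟩ := u.2.2.2 s hs
    have hmem : p j ∈ convexHull ℝ (s : Set (Pt d)) := subset_convexHull ℝ _ hj
    have hIs : I s = ∫ y in convexHull ℝ (s : Set (Pt d)), ‖q y‖ ^ 2 :=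
      setIntegral_congr_fun (isCompact_cell s).measurableSet fun y hy => by simp only [hq hy]
    rw [hIs, ← hux j, hq hmem]
    refine le_trans ?_ (measureReal_mul_norm_sq_le (isCompact_cell s) (convex_convexHull ℝ _)
      hmem q)
    gcongr
    exact hm s hs
  have hex : ∀ j, ∃ s ∈ cells T, p j ∈ s := fun j => by
    have hj : p j ∈ T.vertices := (hrange ▸ Set.mem_range_self j : p j ∈ T.vertices ∩ Ω).1
    obtain ⟨t, ht, hst⟩ := hT.pure _ hj
    exact ⟨t, ht, hst (by simp)⟩
  -- Each node is charged to a single cell containing it, so a cell is charged by at most its d + 1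
  -- vertices.
  choose c hc hpc using hex
  have hcard : ∀ s ∈ cells T, ((Finset.univ.filter fun j => c j = s).card : ℝ) ≤ d + 1 := by
    intro s hs
    have : (Finset.univ.filter fun j => c j = s).card ≤ s.card :=
      Finset.card_le_card_of_injOn p (fun j hj => by
        have h : c j = s := by simpa using hj
        exact h ▸ hpc j) hinj.injOn
    rw [hs.2] at this
    exact_mod_cast this
  calc m * ∑ i, ‖x i‖ ^ 2 = ∑ j, m * ‖x j‖ ^ 2 := Finset.mul_sum _ _ _
    _ ≤ ∑ j, (8 * 2 ^ d + 2) * I (c j) :=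
        Finset.sum_le_sum fun j _ => hloc (c j) (hc j) j (hpc j)
    _ = ∑ s ∈ hT.finite_cells.toFinset, ∑ j with c j = s, (8 * 2 ^ d + 2) * I (c j) :=
        (Finset.sum_fiberwise_of_maps_to (fun j _ => by simpa using hc j) _).symm
    _ = ∑ s ∈ hT.finite_cells.toFinset,
          ((Finset.univ.filter fun j => c j = s).card : ℝ) * ((8 * 2 ^ d + 2) * I s) := by
        refine Finset.sum_congr rfl fun s _ => ?_
        rw [← nsmul_eq_mul, ← Finset.sum_const]
        exact Finset.sum_congr rfl fun j hj => by rw [(Finset.mem_filter.1 hj).2]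
    _ ≤ ∑ s ∈ hT.finite_cells.toFinset, (d + 1 : ℝ) * ((8 * 2 ^ d + 2) * I s) := by
        refine Finset.sum_le_sum fun s hs => ?_
        have := hI0 s
        gcongr
        exact hcard s (by simpa using hs)
    _ = _ := by
        rw [hT.setIntegral_eq_sum u.2, ← Finset.mul_sum, ← Finset.mul_sum, mul_assoc]

end Mesh

end HelmholtzFEM

namespace HelmholtzFEM

/-! ### The finite element matrices as Gram matrices, with bounds uniform over the family. -/

section Assembly

open Matrix
open scoped InnerProductSpace

variable {d n : ℕ} {Ω : Set (Pt d)} {T : Geometry.SimplicialComplex ℝ (Pt d)}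

theorem IsPolyhedralDomain.isBounded (hΩ : IsPolyhedralDomain Ω) : Bornology.IsBounded Ω := by
  obtain ⟨P, hP, hcl⟩ := hΩ.exists_polytopes
  refine Bornology.IsBounded.subset ?_ (subset_closure (s := Ω))
  rw [hcl]
  exact (Bornology.isBounded_biUnion hP).2 fun s _ => (isCompact_cell s).isBounded

theorem Vh_le_H10 : Vh Ω T ≤ H10 Ω := fun _ hu => hu.1

/-- The finite element functions as elements of `L²(Ω)`. -/
noncomputable def feL2 (Ω : Set (Pt d)) (T : Geometry.SimplicialComplex ℝ (Pt d)) :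
    Vh Ω T →ₗ[ℂ] Lp ℂ 2 (volume.restrict Ω) :=
  toL2 Ω ∘ₗ Submodule.inclusion Vh_le_H10

/-- The gradients of finite element functions as elements of `L²(Ω)^d`. -/
noncomputable def feGrad (hΩ : IsOpen Ω) (T : Geometry.SimplicialComplex ℝ (Pt d)) :
    Vh Ω T →ₗ[ℂ] PiLp 2 fun _ : Fin d => Lp ℂ 2 (volume.restrict Ω) :=
  gradL2 hΩ ∘ₗ Submodule.inclusion Vh_le_H10

theorem massMatrix_eq_gram (φ : Module.Basis (Fin n) ℂ (Vh Ω T)) :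
    massMatrix Ω (fun i => (φ i : Pt d → ℂ)) = gram ℂ fun i => feL2 Ω T (φ i) := by
  ext j i
  exact (inner_toL2 (Submodule.inclusion Vh_le_H10 (φ i))
    (Submodule.inclusion Vh_le_H10 (φ j))).symm

theorem stiffnessMatrix_eq_gram (hΩ : IsOpen Ω) (φ : Module.Basis (Fin n) ℂ (Vh Ω T)) :
    stiffnessMatrix Ω (fun i => (φ i : Pt d → ℂ)) = gram ℂ fun i => feGrad hΩ T (φ i) := by
  ext j i
  exact (inner_gradL2 hΩ (Submodule.inclusion Vh_le_H10 (φ i))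
    (Submodule.inclusion Vh_le_H10 (φ j))).symm

theorem preconditionedMatrix_eq_gram (hΩ : IsOpen Ω) (κ σ : ℝ)
    (φ : Module.Basis (Fin n) ℂ (Vh Ω T)) :
    preconditionedMatrix κ σ φ =
      ((gram ℂ fun i => feGrad hΩ T (φ i)) +
        (-(κ : ℂ) ^ 2 + Complex.I * σ) • (gram ℂ fun i => feL2 Ω T (φ i))) *
        (gram ℂ fun i => feGrad hΩ T (φ i))⁻¹ * gram ℂ fun i => feL2 Ω T (φ i) := by
  have h : systemMatrix Ω κ σ (fun i => (φ i : Pt d → ℂ)) =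
      stiffnessMatrix Ω (fun i => (φ i : Pt d → ℂ)) +
        (-(κ : ℂ) ^ 2 + Complex.I * σ) • massMatrix Ω (fun i => (φ i : Pt d → ℂ)) := by
    ext j i
    simp only [systemMatrix, stiffnessMatrix, massMatrix, helmholtzForm, Matrix.of_apply,
      Matrix.add_apply, Matrix.smul_apply, smul_eq_mul]
    ring
  rw [preconditionedMatrix, h, massMatrix_eq_gram, stiffnessMatrix_eq_gram hΩ]

theorem norm_sum_feL2_sq (φ : Module.Basis (Fin n) ℂ (Vh Ω T)) (x : Fin n → ℂ) :
    ‖∑ i, x i • feL2 Ω T (φ i)‖ ^ 2 =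
      ∫ y in Ω, ‖((∑ i, x i • φ i : Vh Ω T) : Pt d → ℂ) y‖ ^ 2 := by
  simp only [← map_smul, ← map_sum]
  exact norm_toL2_sq _

/-- The mass matrices of a quasi-uniform family are uniformly equivalent to `h ^ d`. -/
theorem IsQuasiUniform.exists_mass_bounds {F : Set (Geometry.SimplicialComplex ℝ (Pt d))}
    (hq : IsQuasiUniform F) (hF : ∀ T ∈ F, IsTriangulation Ω T) (hd : 0 < d) (hΩ : Ω.Nonempty) :
    ∃ c C : ℝ, 0 < c ∧ 0 < C ∧ ∀ T ∈ F, ∀ (n : ℕ) (φ : Module.Basis (Fin n) ℂ (Vh Ω T)),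
      IsNodalBasis φ → ∀ x : Fin n → ℂ,
        c * meshSize T ^ d * ∑ i, ‖x i‖ ^ 2 ≤ ‖∑ i, x i • feL2 Ω T (φ i)‖ ^ 2 ∧
        ‖∑ i, x i • feL2 Ω T (φ i)‖ ^ 2 ≤ C * meshSize T ^ d * ∑ i, ‖x i‖ ^ 2 := by
  obtain ⟨γ, hγ, hball⟩ := hq
  set w : ℝ := volume.real (Metric.ball (0 : Pt d) 1)
  have hw : 0 < w :=
    ENNReal.toReal_pos (Metric.measure_ball_pos volume _ one_pos).ne' measure_ball_lt_top.ne
  have hvol (x : Pt d) {r : ℝ} (hr : 0 ≤ r) :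
      volume.real (Metric.closedBall x r) = r ^ d * w := by
    rw [Measure.addHaar_real_closedBall _ _ hr, finrank_euclideanSpace_fin]
  have hD : (0 : ℝ) < (d + 1) * (8 * 2 ^ d + 2) := by positivity
  -- Below, each cell contains a ball of radius γh; above, the cells at a node fit in a ball of
  -- radius h. Here w is the volume of the unit ball.
  refine ⟨γ ^ d * w / ((d + 1) * (8 * 2 ^ d + 2)), w, by positivity, hw,
    fun T hT n φ hφ x => ?_⟩
  have hh := (hF T hT).meshSize_pos hd hΩ
  rw [norm_sum_feL2_sq]
  constructor
  · have h := hφ.le_setIntegral_norm_sq (hF T hT) (m := (γ * meshSize T) ^ d * w)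
      (fun s hs => by
        obtain ⟨z, hz⟩ := hball T hT s hs
        rw [← hvol z (by positivity)]
        exact measureReal_mono hz (isCompact_cell s).measure_lt_top.ne) x
    rw [mul_comm _ (∫ y in Ω, _), ← div_le_iff₀ hD] at h
    refine le_trans (le_of_eq ?_) h
    rw [mul_pow]
    ring
  · refine (hφ.setIntegral_norm_sq_le (hF T hT) x).trans_eq ?_
    rw [hvol _ hh.le]
    ring

end Assembly

end HelmholtzFEM

/-! ### The strip for the field of values and the GMRES rate. -/

theorem theorem4p2 (d : ℕ) (hd : d = 2 ∨ d = 3) (Ω : Set (HelmholtzFEM.Pt d))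
    (hΩ : HelmholtzFEM.IsPolyhedralDomain Ω)
    (F : Set (Geometry.SimplicialComplex ℝ (HelmholtzFEM.Pt d)))
    (hF : ∀ T ∈ F, HelmholtzFEM.IsTriangulation Ω T)
    (hq : HelmholtzFEM.IsQuasiUniform F) :
    (∃ c C : ℝ, 0 < c ∧ 0 < C ∧
      ∀ κ σ : ℝ, 0 < σ → ∀ T ∈ F, ∀ (n : ℕ) (φ : Module.Basis (Fin n) ℂ (HelmholtzFEM.Vh Ω T)),
        HelmholtzFEM.IsNodalBasis φ →
        IsUnit (HelmholtzFEM.stiffnessMatrix Ω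
          (fun i => (φ i : HelmholtzFEM.Pt d → ℂ))).det ∧
        HelmholtzFEM.fieldOfValues (HelmholtzFEM.preconditionedMatrix κ σ φ) ⊆
          {z : ℂ | c * HelmholtzFEM.meshSize T ^ d - κ ^ 2 / σ * z.im ≤ z.re ∧
            z.re ≤ C * HelmholtzFEM.meshSize T ^ d - κ ^ 2 / σ * z.im} ∧
        (0 : ℂ) ∉ HelmholtzFEM.fieldOfValues (HelmholtzFEM.preconditionedMatrix κ σ φ)) ∧
    (∀ κ σ : ℝ, 0 < σ → ∃ ρ : ℝ, 0 ≤ ρ ∧ ρ < 1 ∧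
      ∀ T ∈ F, ∀ (n : ℕ) (φ : Module.Basis (Fin n) ℂ (HelmholtzFEM.Vh Ω T)),
        HelmholtzFEM.IsNodalBasis φ →
        ∀ (b : EuclideanSpace ℂ (Fin n)) (m : ℕ) (x : EuclideanSpace ℂ (Fin n)),
          HelmholtzFEM.IsGMRESIterate (HelmholtzFEM.preconditionedMatrix κ σ φ) b m x →
          ‖Matrix.toEuclideanLin (HelmholtzFEM.preconditionedMatrix κ σ φ) x - b‖ ≤
            ρ ^ m * ‖b‖) := by
  have hd0 : 0 < d := by omega
  have hopen := hΩ.isOpen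
  obtain ⟨P, hP⟩ := HelmholtzFEM.exists_norm_toL2_le hd hopen hΩ.isBounded
  obtain ⟨c, C, hc, hC, hmass⟩ := hq.exists_mass_bounds hF hd0 hΩ.isConnected.nonempty
  have hPoin (T : Geometry.SimplicialComplex ℝ (HelmholtzFEM.Pt d)) (n : ℕ)
      (φ : Module.Basis (Fin n) ℂ (HelmholtzFEM.Vh Ω T)) (x : Fin n → ℂ) :
      ‖∑ i, x i • HelmholtzFEM.feL2 Ω T (φ i)‖ ≤
        P * ‖∑ i, x i • HelmholtzFEM.feGrad hopen T (φ i)‖ := by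
    simp only [← map_smul, ← map_sum]
    exact hP _
  have hpos (T) (hT : T ∈ F) : 0 < HelmholtzFEM.meshSize T ^ d :=
    pow_pos ((hF T hT).meshSize_pos hd0 hΩ.isConnected.nonempty) d
  have hunit (T) (hT : T ∈ F) (n : ℕ) (φ : Module.Basis (Fin n) ℂ (HelmholtzFEM.Vh Ω T))
      (hφ : HelmholtzFEM.IsNodalBasis φ) :
      IsUnit (Matrix.gram ℂ fun i => HelmholtzFEM.feGrad hopen T (φ i)).det :=
    HelmholtzFEM.isUnit_det_gram (mul_pos hc (hpos T hT))
      (fun x => (hmass T hT n φ hφ x).1) (hPoin T n φ)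
  refine ⟨⟨c, C, hc, hC, fun κ σ hσ T hT n φ hφ => ?_⟩, fun κ σ hσ => ?_⟩
  · have hfov : ∀ z ∈ HelmholtzFEM.fieldOfValues (HelmholtzFEM.preconditionedMatrix κ σ φ),
        c * HelmholtzFEM.meshSize T ^ d - κ ^ 2 / σ * z.im ≤ z.re ∧
          z.re ≤ C * HelmholtzFEM.meshSize T ^ d - κ ^ 2 / σ * z.im := by
      intro z hz
      rw [HelmholtzFEM.preconditionedMatrix_eq_gram hopen] at hz
      obtain ⟨s, t, hs, hs', rfl⟩ := HelmholtzFEM.exists_of_mem_fieldOfValues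
        (hunit T hT n φ hφ) (fun x => (hmass T hT n φ hφ x).1)
        (fun x => (hmass T hT n φ hφ x).2) hz
      have hre : ((s : ℂ) + (-(κ : ℂ) ^ 2 + Complex.I * σ) * t).re = s - κ ^ 2 * t := by
        simp [← Complex.ofReal_pow, sub_eq_add_neg]
      have him : ((s : ℂ) + (-(κ : ℂ) ^ 2 + Complex.I * σ) * t).im = σ * t := by
        simp [← Complex.ofReal_pow]
      have hσt : κ ^ 2 / σ * (σ * t) = κ ^ 2 * t := by field_simp
      rw [hre, him, hσt]
      exact ⟨by linarith, by linarith⟩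
    refine ⟨?_, hfov, fun h0 => ?_⟩
    · rw [HelmholtzFEM.stiffnessMatrix_eq_gram hopen]
      exact hunit T hT n φ hφ
    · have h := (hfov 0 h0).1
      have := mul_pos hc (hpos T hT)
      simp only [Complex.zero_re, Complex.zero_im, mul_zero, sub_zero] at h
      linarith
  · set τ : ℂ := -(κ : ℂ) ^ 2 + Complex.I * σ with hτ
    -- Re(θz) = Re z + (κ²/σ) Im z is exactly the quantity confined by the strip.
    set θ : ℂ := 1 - Complex.I * ((κ ^ 2 / σ : ℝ) : ℂ) with hθ
    have hθre : θ.re = 1 := by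
      rw [hθ, Complex.sub_re, Complex.re_mul_ofReal]
      simp
    have hθτ : (θ * τ).re = 0 := by
      have e : θ * τ = ((σ + (κ ^ 2 / σ) * κ ^ 2 : ℝ) : ℂ) * Complex.I := by
        have h1 : ((κ ^ 2 / σ : ℝ) : ℂ) * σ = (κ : ℂ) ^ 2 := by
          rw [← Complex.ofReal_mul, div_mul_cancel₀ _ hσ.ne', Complex.ofReal_pow]
        rw [hθ, hτ, Complex.ofReal_add, Complex.ofReal_mul, Complex.ofReal_pow]
        linear_combination -(Complex.I ^ 2) * h1 - (κ : ℂ) ^ 2 * Complex.I_sq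
      rw [e, Complex.re_ofReal_mul, Complex.I_re, mul_zero]
    have hθ0 : 0 < ‖θ‖ := by
      rw [norm_pos_iff]
      intro h
      rw [h] at hθre
      simp at hθre
    have hB : 0 < ‖θ‖ * ((1 + ‖τ‖ * P ^ 2) * C) := by positivity
    -- Ratio of the coercivity constant to the norm bound, after cancelling h^d.
    set q : ℝ := c / (‖θ‖ * ((1 + ‖τ‖ * P ^ 2) * C)) with hq'
    have hq0 : 0 < q := div_pos hc hB
    -- No proof of q ≤ 1 is required: the square root of a negative number is 0 by convention, and
    -- `Real.sqrt_mul'` asks only that the other factor be nonnegative.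
    refine ⟨√(1 - q ^ 2), Real.sqrt_nonneg _, ?_, fun T hT n φ hφ b m x hx => ?_⟩
    · rw [Real.sqrt_lt' one_pos]
      nlinarith
    · have hh := hpos T hT
      set h : ℝ := HelmholtzFEM.meshSize T ^ d
      refine hx.norm_residual_le (Real.sqrt_nonneg _) (α := ((((c * h) /
        (‖θ‖ * ((1 + ‖τ‖ * P ^ 2) * (C * h))) ^ 2 : ℝ) : ℂ) * θ)) fun r => ?_
      have key := norm_sub_smul_sq_le (mul_pos hc hh).le
        (show 0 < ‖θ‖ * ((1 + ‖τ‖ * P ^ 2) * (C * h)) by positivity)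
        (HelmholtzFEM.re_mul_inner_preconditioned_ge (hunit T hT n φ hφ)
          (fun x => (hmass T hT n φ hφ x).1) hθre hθτ r)
        (by
          rw [mul_assoc ‖θ‖]
          exact mul_le_mul_of_nonneg_left (HelmholtzFEM.norm_preconditioned_le
            (hunit T hT n φ hφ) (mul_pos hC hh).le (fun x => (hmass T hT n φ hφ x).2)
            (hPoin T n φ) τ r) hθ0.le)
      have hqq : c * h / (‖θ‖ * ((1 + ‖τ‖ * P ^ 2) * (C * h))) = q := by
        rw [hq']
        field_simp
      rw [hqq, ← HelmholtzFEM.preconditionedMatrix_eq_gram hopen] at key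
      rw [← Real.sqrt_sq (norm_nonneg r), ← Real.sqrt_mul' _ (sq_nonneg _)]
      exact Real.le_sqrt_of_sq_le key
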